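/- **Setting.** A *finite quasimetric space* is a finite set $\mathcal X$ with a function $d:\mathcal X\times\mathcal X\to[0,\infty)$ such that $d(x,y)=0\iff x=y$ and $d(x,z)\le d(x,y)+d(y,z)$ for all $x,y,z$. For $S\subseteq\mathcal X\times\mathcal X$ and $\hat d:\mathcal X\times\mathcal X\to[0,\infty)$ put $$\mathrm{dis}_S(\hat d)=\Big(\max_{(x,y)\in S,\,x\ne y}\frac{\hat d(x,y)}{d(x,y)}\Big)\Big(\max_{(x,y)\in S,\,x\ne y}\frac{d(x,y)}{\hat d(x,y)}\Big),\qquad \mathrm{vio}(\hat d)=\max_{a,b,c\in\mathcal X}\frac{\hat d(a,c)}{\hat d(a,b)+\hat d(b,c)},$$ with values in $[0,\infty]$, where $\mathrm{dis}_S(\hat d)=\infty$ if $\hat d$ vanishes on some $(x,y)\in S$ with $x\neq y$, and where in $\mathrm{vio}$ one sets $0/0=1$ and $a/0=\infty$ for $a>0$. A *learning algorithm* on $\mathbb R^{2n}$ is a map $\mathsf{Alg}$ that sends every finite set $\mathcal D\subset\mathbb R^{2n}\times\mathbb R$ to a function $\mathsf{Alg}(\mathcal D):\mathbb R^{2n}\to\mathbb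 R$. It is *equivariant to orthogonal transforms* if $\mathsf{Alg}(\mathcal D)=\mathsf{Alg}(T\mathcal D)\circ T$ for every orthogonal transform $T$ of $\mathbb R^{2n}$ and every $\mathcal D$, where $T\mathcal D=\{(Tz,y):(z,y)\in\mathcal D\}$. For $\mathcal X\subset\mathbb R^n$ and $S\subseteq\mathcal X\times\mathcal X$, training on $S$ gives the predictor $\hat d(x,y)=\mathsf{Alg}(\mathcal D_S)(x\oplus y)$, where $\mathcal D_S=\{(x\oplus y,\,d(x,y)):(x,y)\in S\}$ and $x\oplus y\in\mathbb R^{2n}$ is the concatenation of $x$ and $y$. **Theorem (Failure of algorithms equivariant to orthogonal transforms).** Let $(f_n)_n$ be an arbitrary sequence of real numbers. There is a sequence of finite quasimetric spaces $(\mathcal X_n,d_n)$ with $|\mathcal X_n|=n$, where $\mathcal X_n=\{e_1,\dots,e_n\}\subset\mathbb R^n$ is the set of one-hot vectors, such that the following holds. Let $(m_n)_n$ be any sequence of integers with $0\le m_n\le n^2$, $$\frac{m_n}{n^2}=\omega(n^{-1/2})\qquad\text{and}\qquad 1-\frac{m_n}{n^2}=\omega(n^{-1/3}),$$ where $g=\omega(h)$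 means $h=o(g)$. Then there are $\varepsilon_n\to0$ such that for every $n$ and every learning algorithm on $\mathbb R^{2n}$ equivariant to orthogonal transforms, when $S$ is a uniformly random set of $m_n$ pairs from $\mathcal X_n\times\mathcal X_n$, with probability at least $\tfrac12-\varepsilon_n$ the predictor $\hat d$ obtained by training on $S$ satisfies * $\hat d(x,y)<0$ for some $x,y\in\mathcal X_n$, or * $\max(\mathrm{dis}_S(\hat d),\mathrm{vio}(\hat d))\ge f_n$. -/

import Mathlib

open scoped NNReal ENNReal Topology Asymptotics

noncomputable section

namespace QuasimetricLearning

/-- A finite quasimetric space whose points lie in `E`, with finite distances. -/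
structure FiniteQuasimetricSpace (E : Type*) where
  points : Finset E
  dist : points → points → ℝ≥0
  dist_eq_zero_iff : ∀ x y, dist x y = 0 ↔ x = y
  dist_triangle : ∀ x y z, dist x z ≤ dist x y + dist y z

/-- Distortion over the pairs `S` of a non-negative predictor `g` of a quasimetric `d`:
`(max g / d) * (max d / g)`, both maxima over the pairs `(x, y) ∈ S` with `x ≠ y`.
It is `∞` as soon as `g` vanishes on such a pair (so `0 * ∞` counts as `∞` here). -/
def distortion {X : Type*} (d : X → X → ℝ≥0) (S : Finset (X × X)) (g : X → X → ℝ≥0) : ℝ≥0∞ :=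
  open Classical in
  if ∃ p ∈ S, p.1 ≠ p.2 ∧ g p.1 p.2 = 0 then ∞
  else (⨆ p ∈ S, ⨆ (_ : p.1 ≠ p.2), (g p.1 p.2 : ℝ≥0∞) / d p.1 p.2) *
    (⨆ p ∈ S, ⨆ (_ : p.1 ≠ p.2), (d p.1 p.2 : ℝ≥0∞) / g p.1 p.2)

/-- The quotient `a / b` in `[0, ∞]` with the conventions `0 / 0 = 1` and `a / 0 = ∞` for
`a > 0`. -/
def ratio (a b : ℝ≥0) : ℝ≥0∞ :=
  if a = 0 ∧ b = 0 then 1 else (a : ℝ≥0∞) / b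

/-- Quasimetric violation of a non-negative predictor. -/
def violation {X : Type*} (g : X → X → ℝ≥0) : ℝ≥0∞ :=
  ⨆ (a : X) (b : X) (c : X), ratio (g a c) (g a b + g b c)

/-- A learning algorithm sends a finite training set of (input, target) pairs to a function. -/
abbrev LearningAlgorithm (Z Y : Type*) := Finset (Z × Y) → Z → Y

/-- The training set `T D = {(T z, y) : (z, y) ∈ D}`. -/
def transformData {Z Y : Type*} (T : Z → Z) (D : Finset (Z × Y)) : Finset (Z × Y) :=
  open Classical in D.image fun q => (T q.1, q.2)

/-- `Alg` is equivariant to the set `𝒯` of transforms of the input space. -/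
def IsEquivariant {Z Y : Type*} (𝒯 : Set (Z → Z)) (Alg : LearningAlgorithm Z Y) : Prop :=
  ∀ T ∈ 𝒯, ∀ D : Finset (Z × Y), Alg D = Alg (transformData T D) ∘ T

/-- The orthogonal transforms of a real inner product space. -/
def orthogonalTransforms (Z : Type*) [NormedAddCommGroup Z] [InnerProductSpace ℝ Z] :
    Set (Z → Z) :=
  Set.range fun U : Z ≃ₗᵢ[ℝ] Z => (U : Z → Z)

/-- The Euclidean space `ℝ²ⁿ` of concatenations of two vectors of `ℝⁿ`. -/
abbrev PairSpace (n : ℕ) := EuclideanSpace ℝ (Fin n ⊕ Fin n)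

/-- Concatenation of two feature vectors. -/
def concat {n : ℕ} (x y : EuclideanSpace ℝ (Fin n)) : PairSpace n :=
  WithLp.toLp 2 (Sum.elim (fun i => x i) (fun i => y i))

/-- The set of the `n` one-hot vectors (standard basis vectors) of `ℝⁿ`. -/
def oneHot (n : ℕ) : Finset (EuclideanSpace ℝ (Fin n)) :=
  open Classical in Finset.univ.image fun i => EuclideanSpace.single i (1 : ℝ)

/-- The training data `{((x, y), d(x, y)) : (x, y) ∈ S}` with concatenated inputs. -/
def trainingData {n : ℕ} (M : FiniteQuasimetricSpace (EuclideanSpace ℝ (Fin n)))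
    (S : Finset (M.points × M.points)) : Finset (PairSpace n × ℝ) :=
  open Classical in
  S.image fun p => (concat (p.1 : EuclideanSpace ℝ (Fin n)) p.2, (M.dist p.1 p.2 : ℝ))

/-- The predictor on pairs of points output by `Alg` when it is trained on the pairs `S`. -/
def predictor {n : ℕ} (M : FiniteQuasimetricSpace (EuclideanSpace ℝ (Fin n)))
    (Alg : LearningAlgorithm (PairSpace n) ℝ) (S : Finset (M.points × M.points)) :
    M.points → M.points → ℝ :=
  fun x y => Alg (trainingData M S) (concat (x : EuclideanSpace ℝ (Fin n)) y)

/-- A real-valued predictor `g`, trained on `S`, fails at level `t`: it is negative somewhere, or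
its training distortion or its violation is at least `t`. (In the second alternative `g` may be
taken to be non-negative, so `toNNReal` only changes the type of its values.) -/
def Fails {X : Type*} (d : X → X → ℝ≥0) (S : Finset (X × X)) (t : ℝ) (g : X → X → ℝ) : Prop :=
  (∃ x y, g x y < 0) ∨
    ENNReal.ofReal t ≤ max (distortion d S fun x y => (g x y).toNNReal)
      (violation fun x y => (g x y).toNNReal)

/-- Probability of `P S` when `S` is uniform among the `m`-element subsets of `X × X`, that is,
`m` pairs sampled uniformly without replacement. -/
def trainingProb (X : Type*) [Fintype X] (m : ℕ) (P : Finset (X × X) → Prop) : ℝ :=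
  open Classical in
  (((Finset.univ : Finset (X × X)).powersetCard m).filter P).card /
    ((Finset.univ : Finset (X × X)).powersetCard m).card

end QuasimetricLearning

end

/-!
An equivariant algorithm sees a training pair `(x, y)` as the concatenation of two one-hot vectors,
and orthogonal transforms of `ℝ²ⁿ` permute the one-hot vectors in the first component by some `π`
and those in the second one by an unrelated `ρ` (`exists_orthogonal_concat`). So if the distances
satisfy `d (π x) (ρ y) = d x y` for all training pairs, then the predictors trained on `S` and on
its image under `(π, ρ)` are the same function up to `(π, ρ)` (`predictor_map`), although a point
is matched with different copies of itself in the two situations. The triangle inequalities of the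
two matchings can contradict each other.

The gadget has six points `u, a, u', a', g, h`. The distances `d u a`, `d a u` and `d a' u'` are
`1`, and every other distance is huge. Let `π = (a a') (u' g)` and `ρ = (u u') (a' h)`.
The distances are preserved by `(π, ρ)` except at the twelve pairs with `x = y` or `π x = ρ y`,
which must therefore be missing from `S`. If `S` contains `(u, a), (a, u), (a', u'), (a, u')`, then
the triangle inequality along `a, u, a` makes the prediction at `(a, a)` small. After the transform
`ρ a = π a'`, so the triangle inequality bounds the huge prediction at `(a, u')` by those at
`(a, a)` and `(a', u')`, hence the prediction at `(a, a)` is huge. So the algorithm fails on `S` or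
on its image (`fails_or_fails`). The isolated points `g` and `h` lengthen two transpositions of
the mismatch `ρ⁻¹ π` to three-cycles. Each adds one free choice at the price of two missing pairs,
and this brings the expected number of gadgets to order
`n⁴ p⁴ (1 - p) ^ 12 = (n p (1 - p) ^ 3) ^ 4`.

The space consists of `k = n / 6` such blocks. A pattern takes the pair `u, a`, the pair `u', a'`,
the point `g` and the point `h` from independently chosen blocks, so it is given by
`θ : Fin 4 → Fin k`.
Two patterns with `s` common coordinates share at most `2 s` required and `3 s` forbidden pairs.
Hence the relative variance of the number of patterns in a random `S` of density `p` is governed by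
`1 / (n p² (1 - p)³)`, which tends to `0` because `n p²` and `n (1 - p)³` tend to infinity
(`sum_patternCount_sq_le`, `tendsto_sqrt_relVariance`).
Counting the pairs of a training set and a pattern in it, each pair gives a failure either at `S` or
at its image. As the numbers of patterns and of image patterns in `S` are concentrated around the
same mean, at least about half of all training sets fail (`half_sub_sqrt_le_card_div`).
-/

namespace QuasimetricLearning

open Finset

/-! ### Containing and avoiding prescribed elements -/

theorem card_filter_subset_disjoint {U : Type*} [Fintype U] [DecidableEq U] {A B : Finset U}
    (hAB : Disjoint A B) {m : ℕ} (hm : A.card ≤ m) :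
    (((univ : Finset U).powersetCard m).filter fun S => A ⊆ S ∧ Disjoint B S).card =
      (Fintype.card U - (A.card + B.card)).choose (m - A.card) := by
  have hc : (univ \ (A ∪ B)).card = Fintype.card U - (A.card + B.card) := by
    rw [card_sdiff_of_subset (subset_univ _), card_univ, card_union_of_disjoint hAB]
  rw [← hc, ← card_powersetCard]
  refine card_nbij' (fun S => S \ A) (fun T => T ∪ A) ?_ ?_ ?_ ?_
  · intro S hS
    simp only [coe_filter, mem_powersetCard, Set.mem_ofPred_eq] at hS
    obtain ⟨⟨-, hS⟩, hA, hB⟩ := hS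
    simp only [mem_coe, mem_powersetCard]
    refine ⟨fun x hx => ?_, by rw [card_sdiff_of_subset hA, hS]⟩
    have hx' := mem_sdiff.1 hx
    have : x ∉ B := fun h => disjoint_left.1 hB h hx'.1
    simp [hx'.2, this]
  · intro T hT
    simp only [mem_coe, mem_powersetCard] at hT
    have hTA : Disjoint T A := disjoint_left.2 fun x hx h => by
      have := hT.1 hx
      simp [h] at this
    simp only [coe_filter, mem_powersetCard, Set.mem_ofPred_eq]
    refine ⟨⟨subset_univ _, by rw [card_union_of_disjoint hTA, hT.2]; omega⟩,
      subset_union_right, disjoint_union_right.2 ⟨disjoint_left.2 fun x hx h => ?_, hAB.symm⟩⟩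
    have := hT.1 h
    simp [hx] at this
  · intro S hS
    simp only [coe_filter, Set.mem_ofPred_eq] at hS
    exact sdiff_union_of_subset hS.2.1
  · intro T hT
    simp only [mem_coe, mem_powersetCard] at hT
    have hTA : Disjoint T A := disjoint_left.2 fun x hx h => by
      have := hT.1 hx
      simp [h] at this
    simp only [union_sdiff_right]
    exact sdiff_eq_self_of_disjoint hTA

/-- The probability that a uniformly random `m`-element subset of an `N`-element set contains
`a` given elements and avoids `b` other given elements. -/
noncomputable def hitProb (N m a b : ℕ) : ℝ :=
  (m.descFactorial a : ℝ) * (N - m).descFactorial b / N.descFactorial (a + b)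

theorem hitProb_pos {N m a b : ℕ} (ha : a ≤ m) (hb : m + b ≤ N) : 0 < hitProb N m a b := by
  have h1 := Nat.descFactorial_pos.2 ha
  have h2 : 0 < (N - m).descFactorial b := Nat.descFactorial_pos.2 (by omega)
  have h3 : 0 < N.descFactorial (a + b) := Nat.descFactorial_pos.2 (by omega)
  unfold hitProb
  positivity

theorem choose_eq_mul_hitProb {N m a b : ℕ} (ha : a ≤ m) (hb : m + b ≤ N) :
    ((N - (a + b)).choose (m - a) : ℝ) = N.choose m * hitProb N m a b := by
  obtain ⟨x, rfl⟩ := Nat.exists_eq_add_of_le ha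
  obtain ⟨y, rfl⟩ := Nat.exists_eq_add_of_le hb
  have e1 : a + x + b + y - (a + b) = x + y := by omega
  have e2 : a + x - a = x := by omega
  have e3 : a + x + b + y - (a + x) = b + y := by omega
  have e4 : b + y - b = y := by omega
  have h1 := Nat.add_choose_mul_factorial_mul_factorial y x
  have h2 := Nat.factorial_mul_descFactorial (show a ≤ a + x by omega)
  have h3 := Nat.factorial_mul_descFactorial (show b ≤ b + y by omega)
  have h4 := Nat.factorial_mul_descFactorial (show a + b ≤ a + x + b + y by omega)
  have h5 := Nat.add_choose_mul_factorial_mul_factorial (b + y) (a + x)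
  rw [e1] at h4 ⊢
  rw [e2] at h2 ⊢
  rw [e4] at h3
  rw [show b + y + (a + x) = a + x + b + y by ring] at h5
  rw [add_comm y x] at h1
  have hpos : (0 : ℝ) < (a + x + b + y).descFactorial (a + b) := by
    exact_mod_cast Nat.descFactorial_pos.2 (by omega)
  have hx : (x.factorial : ℝ) ≠ 0 := by exact_mod_cast x.factorial_ne_zero
  have hy : (y.factorial : ℝ) ≠ 0 := by exact_mod_cast y.factorial_ne_zero
  unfold hitProb
  rw [e3, ← mul_div_assoc, eq_div_iff hpos.ne']
  refine mul_right_cancel₀ (mul_ne_zero hx hy) ?_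
  have key : (x + y).choose x * (a + x + b + y).descFactorial (a + b) *
      (x.factorial * y.factorial) = (a + x + b + y).choose (a + x) *
      ((a + x).descFactorial a * (b + y).descFactorial b) * (x.factorial * y.factorial) := by
    calc _ = ((x + y).choose x * y.factorial * x.factorial) *
          (a + x + b + y).descFactorial (a + b) := by ring
      _ = (a + x + b + y).choose (a + x) * (y.factorial * (b + y).descFactorial b) *
          (x.factorial * (a + x).descFactorial a) := by rw [h1, h2, h3, h4, h5]
      _ = _ := by ring
  exact_mod_cast key

/-- Dropping one of at most `c` elements to be contained raises the probability at most by the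
factor `N / (m + 1 - c)`. -/
theorem hitProb_le_succ_left {N m a b c : ℕ} (ha : a < c) (hc : c ≤ m)
    (hb : m + b ≤ N) :
    hitProb N m a b ≤ hitProb N m (a + 1) b * ((N : ℝ) / ((m : ℝ) + 1 - c)) := by
  have hN : a + 1 + b ≤ N := by omega
  have h3 : (0 : ℝ) < N.descFactorial (a + b) := by
    exact_mod_cast Nat.descFactorial_pos.2 (by omega)
  have h1 : (0 : ℝ) < m.descFactorial a := by
    exact_mod_cast Nat.descFactorial_pos.2 (by omega)
  have h2 : (0 : ℝ) < (N - m).descFactorial b := by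
    exact_mod_cast Nat.descFactorial_pos.2 (by omega)
  have ha' : (a : ℝ) + 1 ≤ c := by exact_mod_cast ha
  have hc' : (c : ℝ) ≤ m := by exact_mod_cast hc
  have hN' : (a : ℝ) + 1 + b ≤ N := by exact_mod_cast hN
  unfold hitProb
  rw [show a + 1 + b = a + b + 1 by ring, Nat.descFactorial_succ, Nat.descFactorial_succ]
  push_cast [Nat.cast_sub (show a ≤ m by omega), Nat.cast_sub (show a + b ≤ N by omega)]
  have h4 : (0 : ℝ) < N - (a + b) := by linarith
  have h5 : (0 : ℝ) < (m : ℝ) + 1 - c := by linarith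
  rw [div_mul_div_comm, div_le_div_iff₀ h3 (by positivity)]
  have h6 : ((N : ℝ) - (a + b)) * (m + 1 - c) ≤ (m - a) * N := by
    have : (0 : ℝ) ≤ a := by positivity
    have : (0 : ℝ) ≤ b := by positivity
    rw [mul_comm]
    exact mul_le_mul (by linarith) (by linarith) h4.le (by linarith)
  have h7 := mul_le_mul_of_nonneg_left h6
    (mul_pos (mul_pos h1 h2) h3).le
  calc _ = (m.descFactorial a : ℝ) * (N - m).descFactorial b * N.descFactorial (a + b) *
      (((N : ℝ) - (a + b)) * (m + 1 - c)) := by ring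
    _ ≤ _ := h7
    _ = _ := by ring

theorem hitProb_symm {N m a b : ℕ} (hm : m ≤ N) : hitProb N m a b = hitProb N (N - m) b a := by
  unfold hitProb
  rw [Nat.sub_sub_self hm, add_comm b a, mul_comm (m.descFactorial a : ℝ)]

theorem hitProb_le_add_left {N m c b : ℕ} (hc : c ≤ m) (hb : m + b ≤ N) {a k : ℕ}
    (hk : a + k = c) :
    hitProb N m a b ≤ hitProb N m c b * ((N : ℝ) / ((m : ℝ) + 1 - c)) ^ k := by
  have hc' : (c : ℝ) ≤ m := by exact_mod_cast hc
  induction k generalizing a with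
  | zero => simp [← hk]
  | succ k ih =>
    have h0 : (0 : ℝ) ≤ (N : ℝ) / ((m : ℝ) + 1 - c) := div_nonneg (by positivity) (by linarith)
    calc _ ≤ _ := hitProb_le_succ_left (show a < c by omega) hc hb
      _ ≤ (hitProb N m c b * ((N : ℝ) / ((m : ℝ) + 1 - c)) ^ k) *
          ((N : ℝ) / ((m : ℝ) + 1 - c)) := by
        gcongr
        exact ih (by omega)
      _ = _ := by ring

theorem hitProb_le_add_right {N m a d : ℕ} (ha : a ≤ m) (hd : m + d ≤ N) {b k : ℕ}
    (hk : b + k = d) :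
    hitProb N m a b ≤ hitProb N m a d * ((N : ℝ) / ((N : ℝ) - m + 1 - d)) ^ k := by
  have hm : m ≤ N := by omega
  rw [hitProb_symm hm, hitProb_symm hm]
  have := hitProb_le_add_left (N := N) (m := N - m) (c := d) (b := a) (by omega) (by omega) hk
  rwa [Nat.cast_sub hm] at this

/-- Lowering the numbers of prescribed elements from `c` and `d` by at most `2 s` and `3 s`
multiplies the probability by at most the `s`-th power of the given factor. -/
theorem hitProb_le_mul_pow {N m a b c d s : ℕ} (hc : c ≤ m) (hd : m + d ≤ N) (hc1 : 1 ≤ c)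
    (hd1 : 1 ≤ d) (hac : a ≤ c) (hbd : b ≤ d) (ha : c ≤ a + 2 * s) (hb : d ≤ b + 3 * s) :
    hitProb N m a b ≤ hitProb N m c d *
      (((N : ℝ) / ((m : ℝ) + 1 - c)) ^ 2 * ((N : ℝ) / ((N : ℝ) - m + 1 - d)) ^ 3) ^ s := by
  have hc' : (c : ℝ) ≤ m := by exact_mod_cast hc
  have hd' : (m : ℝ) + d ≤ N := by exact_mod_cast hd
  have hc0 : (1 : ℝ) ≤ c := by exact_mod_cast hc1
  have hd0 : (1 : ℝ) ≤ d := by exact_mod_cast hd1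
  have hx : 1 ≤ (N : ℝ) / ((m : ℝ) + 1 - c) := by
    rw [one_le_div (by linarith)]
    linarith
  have hy : 1 ≤ (N : ℝ) / ((N : ℝ) - m + 1 - d) := by
    rw [one_le_div (by linarith)]
    linarith
  set x := (N : ℝ) / ((m : ℝ) + 1 - c)
  set y := (N : ℝ) / ((N : ℝ) - m + 1 - d)
  have hp := (hitProb_pos hc hd).le
  calc hitProb N m a b ≤ hitProb N m c b * x ^ (c - a) :=
        hitProb_le_add_left hc (by omega) (by omega)
    _ ≤ hitProb N m c d * y ^ (d - b) * x ^ (c - a) := by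
        gcongr
        exact hitProb_le_add_right hc hd (by omega)
    _ ≤ hitProb N m c d * y ^ (3 * s) * x ^ (2 * s) := by
        gcongr <;> first | assumption | omega
    _ = _ := by rw [mul_pow, ← pow_mul, ← pow_mul]; ring

/-- Two disjoint patterns are almost independent, although the set is sampled without
replacement. -/
theorem hitProb_two_mul_le {N m a b : ℕ} (ha : 2 * a ≤ m) (hb : m + 2 * b ≤ N) :
    hitProb N m (2 * a) (2 * b) ≤ hitProb N m a b ^ 2 *
      ((N : ℝ) / ((N : ℝ) + 1 - (2 * a + 2 * b : ℕ))) ^ (2 * a + 2 * b) := by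
  have key : ∀ n k : ℕ, n.descFactorial (2 * k) ≤ n.descFactorial k ^ 2 := by
    intro n k
    rw [← Nat.descFactorial_mul_descFactorial (show k ≤ 2 * k by omega), sq,
      show 2 * k - k = k by omega]
    exact Nat.mul_le_mul_right _ (Nat.descFactorial_le k (Nat.sub_le _ _))
  have h1 : (m.descFactorial (2 * a) : ℝ) ≤ (m.descFactorial a : ℝ) ^ 2 := by
    exact_mod_cast key m a
  have h2 : ((N - m).descFactorial (2 * b) : ℝ) ≤ ((N - m).descFactorial b : ℝ) ^ 2 := by
    exact_mod_cast key (N - m) b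
  have hab : ((2 * a + 2 * b : ℕ) : ℝ) ≤ N := by exact_mod_cast (by omega : 2 * a + 2 * b ≤ N)
  have h3 : ((N : ℝ) + 1 - (2 * a + 2 * b : ℕ)) ^ (2 * a + 2 * b) ≤
      N.descFactorial (2 * a + 2 * b) := by
    have h := Nat.pow_sub_le_descFactorial N (2 * a + 2 * b)
    have h' : (((N + 1 - (2 * a + 2 * b) : ℕ) : ℝ)) ^ (2 * a + 2 * b) ≤
      N.descFactorial (2 * a + 2 * b) := by exact_mod_cast h
    rwa [Nat.cast_sub (by omega), Nat.cast_add, Nat.cast_one] at h'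
  have h4 : ((N.descFactorial (a + b) : ℝ)) ^ 2 ≤ (N : ℝ) ^ (2 * a + 2 * b) := by
    have h := Nat.pow_le_pow_left (Nat.descFactorial_le_pow N (a + b)) 2
    rw [← pow_mul, show (a + b) * 2 = 2 * a + 2 * b by ring] at h
    exact_mod_cast h
  have h5 : (0 : ℝ) < N.descFactorial (a + b) := by
    exact_mod_cast Nat.descFactorial_pos.2 (by omega)
  have h6 : (0 : ℝ) < (N : ℝ) + 1 - (2 * a + 2 * b : ℕ) := by linarith
  unfold hitProb
  calc _ ≤ ((m.descFactorial a : ℝ) ^ 2 * ((N - m).descFactorial b : ℝ) ^ 2) /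
        ((N : ℝ) + 1 - (2 * a + 2 * b : ℕ)) ^ (2 * a + 2 * b) := by gcongr
    _ = ((m.descFactorial a : ℝ) * (N - m).descFactorial b / N.descFactorial (a + b)) ^ 2 *
        ((N.descFactorial (a + b) : ℝ) ^ 2 /
          ((N : ℝ) + 1 - (2 * a + 2 * b : ℕ)) ^ (2 * a + 2 * b)) := by
      field_simp
    _ ≤ _ := by
      rw [div_pow (N : ℝ)]
      gcongr

/-! ### Second moments of pattern counts -/

/-- The number of patterns `(A θ, B θ)` realized by `S`, that is, such that `S` contains `A θ`
and avoids `B θ`. -/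
noncomputable def patternCount {U Θ : Type*} [Fintype Θ] [DecidableEq U] (A B : Θ → Finset U)
    (S : Finset U) : ℝ :=
  ∑ θ, if A θ ⊆ S ∧ Disjoint (B θ) S then 1 else 0

theorem sum_ite_subset_disjoint {U : Type*} [Fintype U] [DecidableEq U] {A B : Finset U}
    (hAB : Disjoint A B) {m : ℕ} (ha : A.card ≤ m) (hb : m + B.card ≤ Fintype.card U) :
    (∑ S ∈ (univ : Finset U).powersetCard m, if A ⊆ S ∧ Disjoint B S then (1 : ℝ) else 0) =
      (Fintype.card U).choose m * hitProb (Fintype.card U) m A.card B.card := by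
  rw [sum_boole, card_filter_subset_disjoint hAB ha, choose_eq_mul_hitProb ha hb]

theorem sum_patternCount {U Θ : Type*} [Fintype U] [Fintype Θ] [DecidableEq U]
    {A B : Θ → Finset U} (hAB : ∀ θ, Disjoint (A θ) (B θ)) {a b m : ℕ}
    (hA : ∀ θ, (A θ).card = a) (hB : ∀ θ, (B θ).card = b) (ha : a ≤ m)
    (hb : m + b ≤ Fintype.card U) :
    ∑ S ∈ (univ : Finset U).powersetCard m, patternCount A B S =
      (Fintype.card U).choose m * (Fintype.card Θ * hitProb (Fintype.card U) m a b) := by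
  unfold patternCount
  rw [sum_comm]
  have h : ∀ θ ∈ (univ : Finset Θ), (∑ S ∈ (univ : Finset U).powersetCard m,
      if A θ ⊆ S ∧ Disjoint (B θ) S then (1 : ℝ) else 0) =
      (Fintype.card U).choose m * hitProb (Fintype.card U) m a b := by
    intro θ _
    rw [sum_ite_subset_disjoint (hAB θ) (by rw [hA]; exact ha) (by rw [hB]; exact hb), hA, hB]
  rw [sum_congr rfl h, sum_const, card_univ, nsmul_eq_mul]
  ring

/-- Two patterns that share at most `2 s` prescribed and `3 s` forbidden elements occur together
at most as often as two disjoint patterns do, up to the `s`-th power of a fixed factor. -/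
theorem sum_patternCount_sq_le {U Θ : Type*} [Fintype U] [Fintype Θ] [DecidableEq U]
    {A B : Θ → Finset U} {a b m : ℕ}
    (hA : ∀ θ, (A θ).card = a) (hB : ∀ θ, (B θ).card = b) (ha1 : 1 ≤ a) (hb1 : 1 ≤ b)
    (ha : 2 * a ≤ m) (hb : m + 2 * b ≤ Fintype.card U) (s : Θ → Θ → ℕ)
    (hsA : ∀ θ θ', (A θ ∩ A θ').card ≤ 2 * s θ θ')
    (hsB : ∀ θ θ', (B θ ∩ B θ').card ≤ 3 * s θ θ') :
    ∑ S ∈ (univ : Finset U).powersetCard m, patternCount A B S ^ 2 ≤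
      (Fintype.card U).choose m * (hitProb (Fintype.card U) m (2 * a) (2 * b) *
        ∑ θ, ∑ θ', (((Fintype.card U : ℝ) / ((m : ℝ) + 1 - (2 * a : ℕ))) ^ 2 *
          ((Fintype.card U : ℝ) / ((Fintype.card U : ℝ) - m + 1 - (2 * b : ℕ))) ^ 3) ^
            s θ θ') := by
  set N := Fintype.card U
  set Y : ℝ := ((N : ℝ) / ((m : ℝ) + 1 - (2 * a : ℕ))) ^ 2 *
          ((N : ℝ) / ((N : ℝ) - m + 1 - (2 * b : ℕ))) ^ 3 with hY
  have hsq : ∀ S, patternCount A B S ^ 2 = ∑ θ, ∑ θ', if (A θ ∪ A θ') ⊆ S ∧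
      Disjoint (B θ ∪ B θ') S then (1 : ℝ) else 0 := by
    intro S
    unfold patternCount
    rw [sq, sum_mul_sum]
    refine sum_congr rfl fun θ _ => sum_congr rfl fun θ' _ => ?_
    rw [ite_zero_mul_ite_zero, mul_one]
    refine if_congr ?_ rfl rfl
    rw [union_subset_iff, disjoint_union_left]
    tauto
  rw [sum_congr rfl fun S _ => hsq S, sum_comm, mul_sum, mul_sum]
  refine sum_le_sum fun θ _ => ?_
  rw [sum_comm, mul_sum, mul_sum]
  refine sum_le_sum fun θ' _ => ?_
  have cA := card_union_add_card_inter (A θ) (A θ')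
  have cB := card_union_add_card_inter (B θ) (B θ')
  have iA := hsA θ θ'
  have iB := hsB θ θ'
  rw [hA, hA] at cA
  rw [hB, hB] at cB
  have hd : (m : ℝ) + (2 * b : ℕ) ≤ N := by exact_mod_cast hb
  have hc : ((2 * a : ℕ) : ℝ) ≤ m := by exact_mod_cast ha
  have hY0 : 0 ≤ Y := mul_nonneg (sq_nonneg _)
    (pow_nonneg (div_nonneg (Nat.cast_nonneg _) (by linarith)) _)
  have hp := (hitProb_pos ha hb).le
  by_cases hdis : Disjoint (A θ ∪ A θ') (B θ ∪ B θ')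
  · rw [sum_ite_subset_disjoint hdis (by omega) (by omega)]
    refine mul_le_mul_of_nonneg_left ?_ (Nat.cast_nonneg _)
    exact hitProb_le_mul_pow ha hb (by omega) (by omega) (by omega) (by omega) (by omega)
      (by omega)
  · -- Contradictory requirements are never met.
    rw [sum_eq_zero]
    · positivity
    · intro S _
      rw [if_neg]
      rintro ⟨h1, h2⟩
      exact hdis (disjoint_of_subset_left h1 h2.symm)

/-- A Cauchy-Schwarz argument: if `N₁` and `N₂` have the same mean `μ` and relative variance at
most `v`, and the events `F` carry on average half of `N₁ + N₂`, then `F` has probability at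
least about one half. -/
theorem half_sub_sqrt_le_card_div {α : Type*} {Ω F : Finset α} (hF : F ⊆ Ω) {N₁ N₂ : α → ℝ}
    {μ v : ℝ} (hΩ : Ω.Nonempty) (hμ : 0 < μ)
    (h₁ : ∑ S ∈ Ω, N₁ S = Ω.card * μ) (h₂ : ∑ S ∈ Ω, N₂ S = Ω.card * μ)
    (hv₁ : ∑ S ∈ Ω, N₁ S ^ 2 ≤ Ω.card * (μ ^ 2 * (1 + v)))
    (hv₂ : ∑ S ∈ Ω, N₂ S ^ 2 ≤ Ω.card * (μ ^ 2 * (1 + v)))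
    (hFN : Ω.card * μ ≤ ∑ S ∈ F, (N₁ S + N₂ S)) :
    1 / 2 - √v ≤ (F.card : ℝ) / Ω.card := by
  have hΩ0 : (0 : ℝ) < Ω.card := by exact_mod_cast hΩ.card_pos
  have main : ∀ N : α → ℝ, ∑ S ∈ Ω, N S = Ω.card * μ →
      ∑ S ∈ Ω, N S ^ 2 ≤ Ω.card * (μ ^ 2 * (1 + v)) →
      ∑ S ∈ F, N S ≤ F.card * μ + Ω.card * (μ * √v) := by
    intro N hN hv
    have e1 : ∑ S ∈ Ω, |N S - μ| ^ 2 ≤ Ω.card * (μ ^ 2 * v) := by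
      have : ∑ S ∈ Ω, |N S - μ| ^ 2 =
          ∑ S ∈ Ω, N S ^ 2 - 2 * μ * ∑ S ∈ Ω, N S + Ω.card * μ ^ 2 := by
        rw [mul_sum, ← sum_sub_distrib, ← nsmul_eq_mul, ← sum_const, ← sum_add_distrib]
        refine sum_congr rfl fun S _ => ?_
        rw [sq_abs]
        ring
      rw [this, hN]
      linarith [hv]
    have e2 : ∑ S ∈ Ω, |N S - μ| ≤ Ω.card * (μ * √v) := by
      have h := sq_sum_le_card_mul_sum_sq (s := Ω) (f := fun S => |N S - μ|)
      have h' : (∑ S ∈ Ω, |N S - μ|) ^ 2 ≤ (Ω.card * μ) ^ 2 * v := by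
        calc _ ≤ _ := h
          _ ≤ Ω.card * (Ω.card * (μ ^ 2 * v)) := by gcongr
          _ = _ := by ring
      have h'' := Real.le_sqrt_of_sq_le h'
      rwa [Real.sqrt_mul (sq_nonneg _), Real.sqrt_sq (by positivity), mul_assoc] at h''
    calc ∑ S ∈ F, N S = F.card * μ + ∑ S ∈ F, (N S - μ) := by
          rw [sum_sub_distrib, sum_const, nsmul_eq_mul]
          ring
      _ ≤ F.card * μ + ∑ S ∈ F, |N S - μ| := by
          gcongr
          exact le_abs_self _
      _ ≤ F.card * μ + ∑ S ∈ Ω, |N S - μ| := by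
          gcongr
      _ ≤ _ := by gcongr
  rw [sum_add_distrib] at hFN
  have h := hFN.trans (add_le_add (main N₁ h₁ hv₁) (main N₂ h₂ hv₂))
  rw [le_div_iff₀ hΩ0]
  have h2 : μ * ((1 / 2 - √v) * Ω.card) ≤ μ * F.card := by linarith [h]
  exact le_of_mul_le_mul_left h2 hμ

/-! ### The gadget on six slots -/

/-- The three ordered pairs of slots at distance `1`. The slots `0, 1, 2, 3, 4, 5` hold the points
`u, a, u', a', g, h` of the gadget. -/
def shortSlots : Finset (Fin 6 × Fin 6) := {(0, 1), (1, 0), (3, 2)}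

/-- The coordinate that chooses the point in each slot: slots `0, 1` share one coordinate, and so
do slots `2, 3`, because short distances join these slots. -/
def coord : Fin 6 → Fin 4 := ![0, 0, 1, 1, 2, 3]

/-- The permutation of the slots in the first component of a pair. -/
def leftPerm : Equiv.Perm (Fin 6) := Equiv.swap 1 3 * Equiv.swap 2 4

/-- The permutation of the slots in the second component of a pair. -/
def rightPerm : Equiv.Perm (Fin 6) := Equiv.swap 0 2 * Equiv.swap 3 5

/-- The training pairs from which a contradiction is derived. -/
def requiredSlots : Finset (Fin 6 × Fin 6) := {(0, 1), (1, 0), (3, 2), (1, 2)}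

/-- The image of the required pairs under the two permutations. -/
def requiredSlots' : Finset (Fin 6 × Fin 6) := {(0, 1), (3, 2), (1, 0), (3, 0)}

/-- The pairs whose distance is changed when `leftPerm` and `rightPerm` act on their components:
those on the diagonal, and those moved onto the diagonal. -/
def forbiddenSlots : Finset (Fin 6 × Fin 6) :=
  univ.filter fun p => p.1 = p.2 ∨ leftPerm p.1 = rightPerm p.2

theorem mem_shortSlots_iff_image : ∀ p : Fin 6 × Fin 6,
    (leftPerm p.1, rightPerm p.2) ∈ shortSlots ↔ p ∈ shortSlots := by decide

theorem coord_eq_of_mem_shortSlots : ∀ p ∈ shortSlots, coord p.1 = coord p.2 := by decide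

/-- Short steps compose only to a return, so the triangle inequality holds however large the other
distances are. -/
theorem shortSlots_trans : ∀ a b c : Fin 6, (a, b) ∈ shortSlots → (b, c) ∈ shortSlots →
    a = c := by decide

/-- If `C` is the set of coordinates in which two patterns agree, then the pairs counted here are
those that the patterns have in common. -/
theorem card_requiredSlots_filter : ∀ C : Finset (Fin 4),
    (requiredSlots.filter fun p => coord p.1 ∈ C ∧ coord p.2 ∈ C).card ≤ 2 * C.card := by decide

theorem card_requiredSlots'_filter : ∀ C : Finset (Fin 4),
    (requiredSlots'.filter fun p => coord p.1 ∈ C ∧ coord p.2 ∈ C).card ≤ 2 * C.card := by decide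

theorem card_forbiddenSlots_filter : ∀ C : Finset (Fin 4),
    (forbiddenSlots.filter fun p => coord p.1 ∈ C ∧ coord p.2 ∈ C).card ≤ 3 * C.card := by decide

theorem card_forbiddenSlots : forbiddenSlots.card = 12 := by decide

theorem disjoint_requiredSlots : Disjoint requiredSlots forbiddenSlots := by decide

theorem disjoint_requiredSlots' : Disjoint requiredSlots' forbiddenSlots := by decide

theorem requiredSlots'_eq_map :
    requiredSlots' = requiredSlots.map (leftPerm.prodCongr rightPerm).toEmbedding := by decide

theorem forbiddenSlots_eq_map :
    forbiddenSlots = forbiddenSlots.map (leftPerm.prodCongr rightPerm).toEmbedding := by decide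

/-! ### The gadget inside a larger point set -/

section Gadget

variable {V : Type*} {k : ℕ}

/-- The points that a choice `θ` of coordinates puts into the six slots. -/
def slotEmb (ι : Fin 6 × Fin k ↪ V) (θ : Fin 4 → Fin k) : Fin 6 ↪ V where
  toFun c := ι (c, θ (coord c))
  inj' c c' h := by simpa using congrArg Prod.fst (ι.injective h)

/-- The pairs of points in the given pairs of slots. -/
def slotPairs (ι : Fin 6 × Fin k ↪ V) (P : Finset (Fin 6 × Fin 6)) (θ : Fin 4 → Fin k) :
    Finset (V × V) :=
  P.map ((slotEmb ι θ).prodMap (slotEmb ι θ))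

theorem mem_slotPairs {ι : Fin 6 × Fin k ↪ V} {P : Finset (Fin 6 × Fin 6)} {θ : Fin 4 → Fin k}
    {x y : V} : (x, y) ∈ slotPairs ι P θ ↔
      ∃ c c', (c, c') ∈ P ∧ slotEmb ι θ c = x ∧ slotEmb ι θ c' = y := by
  simp [slotPairs]

/-- The number of coordinates in which two choices agree. -/
def agreement (θ θ' : Fin 4 → Fin k) : ℕ := (univ.filter fun i => θ i = θ' i).card

theorem card_slotPairs_inter_le [DecidableEq V] (ι : Fin 6 × Fin k ↪ V)
    {P : Finset (Fin 6 × Fin 6)} {r : ℕ}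
    (hP : ∀ C : Finset (Fin 4), (P.filter fun p => coord p.1 ∈ C ∧ coord p.2 ∈ C).card ≤
      r * C.card) (θ θ' : Fin 4 → Fin k) :
    (slotPairs ι P θ ∩ slotPairs ι P θ').card ≤ r * agreement θ θ' := by
  refine le_trans ?_ (hP (univ.filter fun i => θ i = θ' i))
  rw [← card_map ((slotEmb ι θ).prodMap (slotEmb ι θ))]
  refine card_le_card ?_
  rintro ⟨x, y⟩ hxy
  obtain ⟨h1, h2⟩ := mem_inter.1 hxy
  obtain ⟨c, c', hc, rfl, rfl⟩ := mem_slotPairs.1 h1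
  obtain ⟨e, e', -, he, he'⟩ := mem_slotPairs.1 h2
  obtain ⟨h3, h4⟩ := Prod.ext_iff.1 (ι.injective he)
  obtain ⟨h5, h6⟩ := Prod.ext_iff.1 (ι.injective he')
  simp only at h3 h4 h5 h6
  subst h3 h5
  simp only [mem_map, mem_filter, mem_univ, true_and]
  exact ⟨(e, e'), ⟨hc, h4.symm, h6.symm⟩, rfl⟩

theorem sum_pow_agreement (Y : ℝ) (θ : Fin 4 → Fin k) :
    ∑ θ' : Fin 4 → Fin k, Y ^ agreement θ θ' = ((k : ℝ) - 1 + Y) ^ 4 := by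
  have h1 : ∀ θ' : Fin 4 → Fin k, Y ^ agreement θ θ' = ∏ i, if θ i = θ' i then Y else 1 := by
    intro θ'
    rw [agreement, prod_ite, prod_const, prod_const_one, mul_one]
  have h2 : ∀ x : Fin k, (∑ y : Fin k, if x = y then Y else 1) = (k : ℝ) - 1 + Y := by
    intro x
    have : ∀ y : Fin k, (if x = y then Y else 1) = (if x = y then Y - 1 else 0) + 1 := by
      intro y
      split_ifs <;> ring
    rw [sum_congr rfl fun y _ => this y, sum_add_distrib, sum_ite_eq]
    simp
    ring
  have h3 := prod_univ_sum (fun _ : Fin 4 => (univ : Finset (Fin k)))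
    fun i y => if θ i = y then Y else 1
  rw [Fintype.piFinset_univ] at h3
  rw [sum_congr rfl fun θ' _ => h1 θ', ← h3, prod_congr rfl fun i _ => h2 (θ i), prod_const,
    card_univ, Fintype.card_fin]

/-- The points `x` and `y` lie in one block, in two slots at distance `1`. -/
def IsShort (ι : Fin 6 × Fin k ↪ V) (x y : V) : Prop :=
  ∃ p ∈ shortSlots, ∃ b, x = ι (p.1, b) ∧ y = ι (p.2, b)

/-- The quasimetric with value `1` at the short pairs and value `L` at all other pairs of
different points. -/
noncomputable def gadgetDist (ι : Fin 6 × Fin k ↪ V) (L : ℝ≥0) (x y : V) : ℝ≥0 :=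
  open Classical in if x = y then 0 else if IsShort ι x y then 1 else L

theorem gadgetDist_eq_zero_iff (ι : Fin 6 × Fin k ↪ V) {L : ℝ≥0} (hL : 1 ≤ L) (x y : V) :
    gadgetDist ι L x y = 0 ↔ x = y := by
  unfold gadgetDist
  have : L ≠ 0 := (zero_lt_one.trans_le hL).ne'
  split_ifs <;> simp_all

theorem gadgetDist_triangle (ι : Fin 6 × Fin k ↪ V) {L : ℝ≥0} (hL : 1 ≤ L) (x y z : V) :
    gadgetDist ι L x z ≤ gadgetDist ι L x y + gadgetDist ι L y z := by
  by_cases hxy : x = y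
  · subst hxy
    exact le_add_self
  by_cases hyz : y = z
  · subst hyz
    exact le_self_add
  by_cases hxz : x = z
  · simp [gadgetDist, hxz]
  by_cases h1 : IsShort ι x y
  · by_cases h2 : IsShort ι y z
    · exfalso
      obtain ⟨p, hp, b, rfl, rfl⟩ := h1
      obtain ⟨q, hq, b', hb, rfl⟩ := h2
      obtain ⟨h3, h4⟩ := Prod.ext_iff.1 (ι.injective hb)
      simp only at h3 h4
      subst h4
      have := shortSlots_trans p.1 q.1 q.2 (by rw [← h3]; exact hp) hq
      exact hxz (by rw [this])
    · simp only [gadgetDist, hxy, hyz, hxz, h1, h2, if_true, if_false]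
      split_ifs
      · exact le_self_add
      · exact le_add_self
  · simp only [gadgetDist, hxy, hyz, hxz, h1, if_false]
    split_ifs
    · exact hL.trans le_self_add
    · exact hL.trans le_self_add
    · exact le_self_add
    · exact le_self_add

theorem IsShort.exists_slot_right {ι : Fin 6 × Fin k ↪ V} {θ : Fin 4 → Fin k} {c : Fin 6} {y : V}
    (h : IsShort ι (slotEmb ι θ c) y) : ∃ c', y = slotEmb ι θ c' ∧ (c, c') ∈ shortSlots := by
  obtain ⟨p, hp, b, h1, rfl⟩ := h
  obtain ⟨h3, h4⟩ := Prod.ext_iff.1 (ι.injective h1)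
  simp only at h3 h4
  subst h3 h4
  exact ⟨p.2, by rw [coord_eq_of_mem_shortSlots p hp]; rfl, hp⟩

theorem IsShort.exists_slot_left {ι : Fin 6 × Fin k ↪ V} {θ : Fin 4 → Fin k} {c : Fin 6} {x : V}
    (h : IsShort ι x (slotEmb ι θ c)) : ∃ c', x = slotEmb ι θ c' ∧ (c', c) ∈ shortSlots := by
  obtain ⟨p, hp, b, rfl, h1⟩ := h
  obtain ⟨h3, h4⟩ := Prod.ext_iff.1 (ι.injective h1)
  simp only at h3 h4
  subst h3 h4
  exact ⟨p.1, by rw [← coord_eq_of_mem_shortSlots p hp]; rfl, hp⟩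

theorem isShort_slotEmb {ι : Fin 6 × Fin k ↪ V} {θ : Fin 4 → Fin k} {c c' : Fin 6} :
    IsShort ι (slotEmb ι θ c) (slotEmb ι θ c') ↔ (c, c') ∈ shortSlots := by
  constructor
  · intro h
    obtain ⟨e, he, h⟩ := h.exists_slot_right
    rwa [(slotEmb ι θ).injective he]
  · intro h
    exact ⟨(c, c'), h, θ (coord c), rfl,
      congrArg (fun i => ι (c', θ i)) (coord_eq_of_mem_shortSlots _ h).symm⟩

theorem gadgetDist_slotEmb {ι : Fin 6 × Fin k ↪ V} {θ : Fin 4 → Fin k} {L : ℝ≥0} {c c' : Fin 6} :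
    gadgetDist ι L (slotEmb ι θ c) (slotEmb ι θ c') =
      if c = c' then 0 else if (c, c') ∈ shortSlots then 1 else L := by
  simp only [gadgetDist, isShort_slotEmb, (slotEmb ι θ).injective.eq_iff]

variable [DecidableEq V]

/-- A permutation of the slots, acting on the points in them. -/
def slotPerm (ι : Fin 6 × Fin k ↪ V) (θ : Fin 4 → Fin k) (σ : Equiv.Perm (Fin 6)) :
    Equiv.Perm V :=
  σ.viaFintypeEmbedding (slotEmb ι θ)

theorem slotPerm_slotEmb (ι : Fin 6 × Fin k ↪ V) (θ : Fin 4 → Fin k) (σ : Equiv.Perm (Fin 6))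
    (c : Fin 6) : slotPerm ι θ σ (slotEmb ι θ c) = slotEmb ι θ (σ c) :=
  Equiv.Perm.viaFintypeEmbedding_apply_image ..

theorem slotPerm_of_notMem (ι : Fin 6 × Fin k ↪ V) (θ : Fin 4 → Fin k) (σ : Equiv.Perm (Fin 6))
    {x : V} (hx : x ∉ Set.range (slotEmb ι θ)) : slotPerm ι θ σ x = x :=
  Equiv.Perm.viaFintypeEmbedding_apply_notMem_range _ _ hx

/-- Away from the forbidden pairs, permuting the two components separately preserves the
distance. -/
theorem gadgetDist_slotPerm (ι : Fin 6 × Fin k ↪ V) (θ : Fin 4 → Fin k) (L : ℝ≥0) {x y : V}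
    (h : (x, y) ∉ slotPairs ι forbiddenSlots θ) :
    gadgetDist ι L (slotPerm ι θ leftPerm x) (slotPerm ι θ rightPerm y) =
      gadgetDist ι L x y := by
  by_cases hx : x ∈ Set.range (slotEmb ι θ)
  · obtain ⟨c, rfl⟩ := hx
    by_cases hy : y ∈ Set.range (slotEmb ι θ)
    · obtain ⟨c', rfl⟩ := hy
      have hc : (c, c') ∉ forbiddenSlots := fun hc => h (mem_slotPairs.2 ⟨c, c', hc, rfl, rfl⟩)
      simp only [forbiddenSlots, mem_filter, mem_univ, true_and, not_or] at hc
      rw [slotPerm_slotEmb, slotPerm_slotEmb, gadgetDist_slotEmb, gadgetDist_slotEmb,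
        if_neg hc.1, if_neg hc.2]
      exact if_congr (mem_shortSlots_iff_image (c, c')) rfl rfl
    · rw [slotPerm_slotEmb, slotPerm_of_notMem ι θ _ hy]
      have key : ∀ e, gadgetDist ι L (slotEmb ι θ e) y = L := by
        intro e
        have h1 : slotEmb ι θ e ≠ y := fun h => hy ⟨e, h⟩
        have h2 : ¬ IsShort ι (slotEmb ι θ e) y := fun h => by
          obtain ⟨e', he', -⟩ := h.exists_slot_right
          exact hy ⟨e', he'.symm⟩
        rw [gadgetDist, if_neg h1, if_neg h2]
      rw [key, key]
  · rw [slotPerm_of_notMem ι θ _ hx]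
    by_cases hy : y ∈ Set.range (slotEmb ι θ)
    · obtain ⟨c', rfl⟩ := hy
      rw [slotPerm_slotEmb]
      have key : ∀ e, gadgetDist ι L x (slotEmb ι θ e) = L := by
        intro e
        have h1 : x ≠ slotEmb ι θ e := fun h => hx ⟨e, h.symm⟩
        have h2 : ¬ IsShort ι x (slotEmb ι θ e) := fun h => by
          obtain ⟨e', he', -⟩ := h.exists_slot_left
          exact hx ⟨e', he'.symm⟩
        rw [gadgetDist, if_neg h1, if_neg h2]
      rw [key, key]
    · rw [slotPerm_of_notMem ι θ _ hy]

end Gadget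

/-! ### Incompatible triangle inequalities -/

theorem mul_lt_of_distortion_lt {X : Type*} {d g : X → X → ℝ≥0} {S : Finset (X × X)} {T : ℝ≥0}
    (h : distortion d S g < T) {p q : X × X} (hp : p ∈ S) (hq : q ∈ S) (hp' : p.1 ≠ p.2)
    (hq' : q.1 ≠ q.2) (hd : d p.1 p.2 ≠ 0) :
    g p.1 p.2 * d q.1 q.2 < T * (g q.1 q.2 * d p.1 p.2) := by
  unfold distortion at h
  split_ifs at h with h0
  · exact absurd h (by simp)
  push Not at h0
  have hgq := h0 q hq hq'
  have h1 : (g p.1 p.2 : ℝ≥0∞) / d p.1 p.2 * ((d q.1 q.2 : ℝ≥0∞) / g q.1 q.2) < T := by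
    refine lt_of_le_of_lt (mul_le_mul' ?_ ?_) h
    · exact le_iSup₂_of_le p hp (le_iSup_of_le hp' le_rfl)
    · exact le_iSup₂_of_le q hq (le_iSup_of_le hq' le_rfl)
  rw [← ENNReal.coe_div hd, ← ENNReal.coe_div hgq, ← ENNReal.coe_mul, ENNReal.coe_lt_coe,
    div_mul_div_comm, div_lt_iff₀ (by positivity)] at h1
  rwa [mul_comm (g q.1 q.2)]

theorem le_mul_of_violation_lt {X : Type*} {g : X → X → ℝ≥0} {T : ℝ≥0} (h : violation g < T)
    (a b c : X) : g a c ≤ T * (g a b + g b c) := by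
  have h1 : ratio (g a c) (g a b + g b c) < T := by
    refine lt_of_le_of_lt ?_ h
    exact le_iSup_of_le a (le_iSup_of_le b
      (le_iSup (fun c => ratio (g a c) (g a b + g b c)) c))
  unfold ratio at h1
  split_ifs at h1 with h0
  · simp [h0.1]
  by_cases hs : g a b + g b c = 0
  · have : g a c ≠ 0 := fun h => h0 ⟨h, hs⟩
    rw [hs, ENNReal.coe_zero, ENNReal.div_zero (by simpa using this)] at h1
    exact absurd h1 (by simp)
  · rw [← ENNReal.coe_div hs, ENNReal.coe_lt_coe, div_lt_iff₀ (by positivity)] at h1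
    exact h1.le

/-- The value of the long distances. With distortion and violation below `T`, the prediction at a
long distance would be at most itself times `(2 * T ^ 3 + T ^ 2) / longDist T`, a factor below
`1`. -/
def longDist (T : ℝ≥0) : ℝ≥0 := 2 * T ^ 3 + T ^ 2 + 1

/-- Let the predictors `g` and `g'` agree up to permuting the two components of pairs by `π` and
`ρ`. The first one has to make `g a a` small, because of the triangle inequality through `u`.
The second one has to make it large, because the triangle inequality through `ρ a = π a'` bounds
the large value at `(a, u')` by the values at `(a, a)` and `(a', u')`. -/
theorem fails_or_fails {X : Type*} {d : X → X → ℝ≥0} {S S' : Finset (X × X)} {t : ℝ}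
    {g g' : X → X → ℝ} {π ρ : X → X} (hg : ∀ x y, g x y = g' (π x) (ρ y)) {u a u' a' : X}
    (hmid : ρ a = π a') (hua : (u, a) ∈ S) (hau : (a, u) ∈ S) (hau' : (a', u') ∈ S)
    (hlong : (a, u') ∈ S) (nua : u ≠ a) (nau' : a' ≠ u') (nlong : a ≠ u')
    (dua : d u a = 1) (dau : d a u = 1) (dau' : d a' u' = 1)
    (dlong : d a u' = longDist t.toNNReal) :
    Fails d S t g ∨ Fails d S' t g' := by
  by_contra hcon
  obtain ⟨h, h'⟩ := not_or.1 hcon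
  unfold Fails at h h'
  obtain ⟨-, h⟩ := not_or.1 h
  obtain ⟨-, h'⟩ := not_or.1 h'
  rw [not_le, max_lt_iff] at h h'
  obtain ⟨hdis, hvio⟩ := h
  obtain ⟨-, hvio'⟩ := h'
  set T := t.toNNReal
  change _ < ((T : ℝ≥0) : ℝ≥0∞) at hdis hvio hvio'
  set G : X → X → ℝ≥0 := fun x y => (g x y).toNNReal
  have hG : ∀ x y, (g' (π x) (ρ y)).toNNReal = G x y := fun x y => by rw [← hg]
  have h1 := le_mul_of_violation_lt hvio a u a
  have h2 := le_mul_of_violation_lt hvio' (π a) (ρ a) (ρ u')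
  simp only [hG] at h2
  rw [hmid, hG] at h2
  have e1 := mul_lt_of_distortion_lt hdis hua hlong nua nlong (by simp [dua])
  have e2 := mul_lt_of_distortion_lt hdis hau hlong nua.symm nlong (by simp [dau])
  have e3 := mul_lt_of_distortion_lt hdis hau' hlong nau' nlong (by simp [dau'])
  simp only [dua, dau, dau', dlong, mul_one] at e1 e2 e3
  change G a a ≤ T * (G a u + G u a) at h1
  change G a u' ≤ T * (G a a + G a' u') at h2
  change G u a * _ < T * G a u' at e1
  change G a u * _ < T * G a u' at e2
  change G a' u' * _ < T * G a u' at e3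
  have h3 : longDist T * G a u' ≤ (2 * T ^ 3 + T ^ 2) * G a u' := by
    calc longDist T * G a u' ≤ longDist T * (T * (T * (G a u + G u a) + G a' u')) := by
          gcongr
          exact h2.trans (by gcongr)
      _ = T * (T * (G a u * longDist T + G u a * longDist T) + G a' u' * longDist T) := by ring
      _ ≤ T * (T * (T * G a u' + T * G a u') + T * G a u') := by gcongr
      _ = _ := by ring
  have h4 : G a u' = 0 := by
    rw [longDist, add_mul _ 1, one_mul] at h3
    exact nonpos_iff_eq_zero.1 (by simpa using h3)
  rw [h4, mul_zero] at e1
  exact not_lt_zero e1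

theorem fails_or_fails_of_slots {V : Type*} [DecidableEq V] {k : ℕ} {ι : Fin 6 × Fin k ↪ V}
    {θ : Fin 4 → Fin k} {S S' : Finset (V × V)} {t : ℝ} {g g' : V → V → ℝ}
    (hg : ∀ x y, g x y = g' (slotPerm ι θ leftPerm x) (slotPerm ι θ rightPerm y))
    (hS : slotPairs ι requiredSlots θ ⊆ S) :
    Fails (gadgetDist ι (longDist t.toNNReal)) S t g ∨
      Fails (gadgetDist ι (longDist t.toNNReal)) S' t g' := by
  have hmem : ∀ c c', (c, c') ∈ requiredSlots → (slotEmb ι θ c, slotEmb ι θ c') ∈ S :=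
    fun c c' h => hS (mem_slotPairs.2 ⟨c, c', h, rfl, rfl⟩)
  have hne : ∀ c c' : Fin 6, c ≠ c' → slotEmb ι θ c ≠ slotEmb ι θ c' :=
    fun c c' h => (slotEmb ι θ).injective.ne h
  refine fails_or_fails hg (u := slotEmb ι θ 0) (a := slotEmb ι θ 1) (u' := slotEmb ι θ 2)
    (a' := slotEmb ι θ 3) ?_ (hmem 0 1 (by decide)) (hmem 1 0 (by decide))
    (hmem 3 2 (by decide)) (hmem 1 2 (by decide)) (hne _ _ (by decide)) (hne _ _ (by decide))
    (hne _ _ (by decide)) ?_ ?_ ?_ ?_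
  · rw [slotPerm_slotEmb, slotPerm_slotEmb]
    exact congrArg _ (by decide)
  · rw [gadgetDist_slotEmb, if_neg (by decide), if_pos (by decide)]
  · rw [gadgetDist_slotEmb, if_neg (by decide), if_pos (by decide)]
  · rw [gadgetDist_slotEmb, if_neg (by decide), if_pos (by decide)]
  · rw [gadgetDist_slotEmb, if_neg (by decide), if_neg (by decide)]

/-! ### The failure probability -/

/-- A bound on the relative variance of the number of gadget patterns in a random set of `m` out
of `N` pairs of points, when every coordinate has `k` possible values. A pattern has `4` required
and `12` forbidden pairs. The first factor is the error of sampling without replacement, and the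
second one is due to patterns with common coordinates. -/
noncomputable def relVariance (N m k : ℕ) : ℝ :=
  ((N : ℝ) / ((N : ℝ) + 1 - (2 * 4 + 2 * 12 : ℕ))) ^ (2 * 4 + 2 * 12) *
    (1 + (((N : ℝ) / ((m : ℝ) + 1 - (2 * 4 : ℕ))) ^ 2 *
      ((N : ℝ) / ((N : ℝ) - m + 1 - (2 * 12 : ℕ))) ^ 3) / k) ^ 4 - 1

section Probability

variable {V : Type*} [DecidableEq V] {k : ℕ}

/-- The bijection of training sets that permutes the two components of every pair separately. -/
def swapPairs (ι : Fin 6 × Fin k ↪ V) (θ : Fin 4 → Fin k) :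
    Finset (V × V) ≃ Finset (V × V) :=
  ((slotPerm ι θ leftPerm).prodCongr (slotPerm ι θ rightPerm)).finsetCongr

theorem swapPairs_apply (ι : Fin 6 × Fin k ↪ V) (θ : Fin 4 → Fin k) (S : Finset (V × V)) :
    swapPairs ι θ S =
      S.map ((slotPerm ι θ leftPerm).prodCongr (slotPerm ι θ rightPerm)).toEmbedding := rfl

theorem slotPairs_eq_map (ι : Fin 6 × Fin k ↪ V) (θ : Fin 4 → Fin k)
    {P P' : Finset (Fin 6 × Fin 6)} (h : P' = P.map (leftPerm.prodCongr rightPerm).toEmbedding) :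
    slotPairs ι P' θ = swapPairs ι θ (slotPairs ι P θ) := by
  subst h
  rw [swapPairs_apply, slotPairs, slotPairs, map_map, map_map]
  congr 1
  ext p
  · exact (slotPerm_slotEmb ι θ leftPerm p.1).symm
  · exact (slotPerm_slotEmb ι θ rightPerm p.2).symm

/-- If every pattern in a training set forces `P` at this set or at its image, then `P` has
probability at least about one half. -/
theorem half_sub_sqrt_relVariance_le [Fintype V] {m : ℕ} (ι : Fin 6 × Fin k ↪ V) (hk : 1 ≤ k)
    (hm : 8 ≤ m) (hm' : m + 24 ≤ Fintype.card (V × V)) {P : Finset (V × V) → Prop}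
    (hP : ∀ θ S, slotPairs ι requiredSlots θ ⊆ S → Disjoint (slotPairs ι forbiddenSlots θ) S →
      P S ∨ P (swapPairs ι θ S)) :
    1 / 2 - √(relVariance (Fintype.card (V × V)) m k) ≤ trainingProb V m P := by
  classical
  set N := Fintype.card (V × V)
  set Ω := (univ : Finset (V × V)).powersetCard m with hΩdef
  have hΩ : Ω.card = N.choose m := by rw [card_powersetCard, card_univ]
  set A := slotPairs ι requiredSlots with hA
  set A' := slotPairs ι requiredSlots' with hA'
  set B := slotPairs ι forbiddenSlots with hB
  have cA : ∀ θ, (A θ).card = 4 := fun θ => card_map _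
  have cA' : ∀ θ, (A' θ).card = 4 := fun θ => card_map _
  have cB : ∀ θ, (B θ).card = 12 := fun θ => (card_map _).trans card_forbiddenSlots
  have hAB : ∀ θ, Disjoint (A θ) (B θ) := fun θ => (disjoint_map _).2 disjoint_requiredSlots
  have hAB' : ∀ θ, Disjoint (A' θ) (B θ) := fun θ => (disjoint_map _).2 disjoint_requiredSlots'
  set μ : ℝ := Fintype.card (Fin 4 → Fin k) * hitProb N m 4 12 with hμdef
  have hp := hitProb_pos (show 4 ≤ m by omega) (show m + 12 ≤ N by omega)
  have hk0 : (1 : ℝ) ≤ k := by exact_mod_cast hk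
  have hcΘ : (Fintype.card (Fin 4 → Fin k) : ℝ) = (k : ℝ) ^ 4 := by simp
  have hμ : 0 < μ := by
    rw [hμdef, hcΘ]
    positivity
  have h1 : (8 : ℝ) ≤ m := by exact_mod_cast hm
  have h2 : (m : ℝ) + 24 ≤ N := by exact_mod_cast hm'
  set Y : ℝ := ((N : ℝ) / ((m : ℝ) + 1 - (2 * 4 : ℕ))) ^ 2 *
      ((N : ℝ) / ((N : ℝ) - m + 1 - (2 * 12 : ℕ))) ^ 3 with hYdef
  have hY0 : 0 ≤ Y := by
    refine mul_nonneg (sq_nonneg _) (pow_nonneg (div_nonneg (Nat.cast_nonneg _) ?_) _)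
    push_cast
    linarith
  have second : ∀ Q : Finset (Fin 6 × Fin 6), (∀ θ, (slotPairs ι Q θ).card = 4) →
      (∀ C : Finset (Fin 4), (Q.filter fun p => coord p.1 ∈ C ∧ coord p.2 ∈ C).card ≤
        2 * C.card) →
      ∑ S ∈ Ω, patternCount (slotPairs ι Q) B S ^ 2 ≤
        Ω.card * (μ ^ 2 * (1 + relVariance N m k)) := by
    intro Q hQ hQC
    have h := sum_patternCount_sq_le (m := m) hQ cB (by norm_num) (by norm_num) (by omega)
      (by omega) agreement (card_slotPairs_inter_le ι hQC)
      (card_slotPairs_inter_le ι card_forbiddenSlots_filter)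
    simp only [sum_pow_agreement, sum_const, card_univ, nsmul_eq_mul, hcΘ] at h
    rw [hΩ]
    refine h.trans (mul_le_mul_of_nonneg_left ?_ (Nat.cast_nonneg _))
    have h3 := hitProb_two_mul_le (N := N) (m := m) (a := 4) (b := 12) (by omega) (by omega)
    rw [← hYdef]
    have h4 : (k : ℝ) - 1 + Y ≤ k + Y := by linarith
    have h5 : 0 ≤ (k : ℝ) - 1 + Y := by linarith
    have h6 : 0 ≤ (k : ℝ) ^ 4 * ((k : ℝ) - 1 + Y) ^ 4 := by positivity
    calc _ ≤ (hitProb N m 4 12 ^ 2 * ((N : ℝ) /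
          ((N : ℝ) + 1 - (2 * 4 + 2 * 12 : ℕ))) ^ (2 * 4 + 2 * 12)) *
          ((k : ℝ) ^ 4 * ((k : ℝ) - 1 + Y) ^ 4) := mul_le_mul_of_nonneg_right h3 h6
      _ ≤ (hitProb N m 4 12 ^ 2 * ((N : ℝ) /
          ((N : ℝ) + 1 - (2 * 4 + 2 * 12 : ℕ))) ^ (2 * 4 + 2 * 12)) *
          ((k : ℝ) ^ 4 * ((k : ℝ) + Y) ^ 4) := by
        refine mul_le_mul_of_nonneg_left ?_ (mul_nonneg (sq_nonneg _)
          (pow_nonneg (div_nonneg (Nat.cast_nonneg _) ?_) _))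
        · gcongr
        · push_cast
          linarith
      _ = _ := by
        have e : (k : ℝ) + Y = k * (1 + Y / k) := by field_simp
        rw [e, relVariance, ← hYdef, hμdef, hcΘ]
        ring
  have hsum := sum_patternCount (m := m) hAB cA cB (by omega) (by omega)
  have hsum' := sum_patternCount (m := m) hAB' cA' cB (by omega) (by omega)
  rw [← hΩdef, ← hΩ] at hsum hsum'
  unfold trainingProb
  rw [← hΩdef]
  have main : Ω.card * μ ≤ ∑ S ∈ Ω.filter P, (patternCount A B S + patternCount A' B S) := by
    rw [← hsum, sum_add_distrib]
    simp only [patternCount]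
    rw [sum_comm, sum_comm (s := Ω.filter P), sum_comm (s := Ω.filter P), ← sum_add_distrib]
    refine sum_le_sum fun θ _ => ?_
    have hequiv : ∀ S, S ∈ Ω ↔ swapPairs ι θ S ∈ Ω := by
      intro S
      simp [hΩdef, mem_powersetCard, swapPairs_apply]
    have hBmap : B θ = swapPairs ι θ (B θ) := slotPairs_eq_map ι θ forbiddenSlots_eq_map
    have hAmap : A' θ = swapPairs ι θ (A θ) := slotPairs_eq_map ι θ requiredSlots'_eq_map
    -- Counting the failures at the image of `S` is counting image patterns in failing sets.
    have hre : (∑ S ∈ Ω, if P S then if A' θ ⊆ S ∧ Disjoint (B θ) S then (1 : ℝ) else 0 else 0) =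
        ∑ S ∈ Ω, if P (swapPairs ι θ S) then if A' θ ⊆ swapPairs ι θ S ∧
          Disjoint (B θ) (swapPairs ι θ S) then (1 : ℝ) else 0 else 0 :=
      (sum_equiv (swapPairs ι θ) hequiv fun S _ => rfl).symm
    rw [sum_filter, sum_filter, hre, ← sum_add_distrib]
    refine sum_le_sum fun S _ => ?_
    have e1 : A' θ ⊆ swapPairs ι θ S ↔ A θ ⊆ S := by
      rw [hAmap]
      exact map_subset_map
    have e2 : Disjoint (B θ) (swapPairs ι θ S) ↔ Disjoint (B θ) S := by
      rw [hBmap]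
      exact (disjoint_map _).trans (by rw [← hBmap])
    simp only [e1, e2]
    have h7 := hP θ S
    by_cases h8 : A θ ⊆ S ∧ Disjoint (B θ) S
    · rcases h7 h8.1 h8.2 with h9 | h9
      · simp only [h8, h9, and_self, if_true]
        split_ifs <;> norm_num
      · simp only [h8, h9, and_self, if_true]
        split_ifs <;> norm_num
    · simp [h8]
  exact half_sub_sqrt_le_card_div (filter_subset _ _) (N₁ := patternCount A B)
    (N₂ := patternCount A' B) (by
      rw [powersetCard_nonempty, card_univ]
      omega) hμ hsum hsum' (second _ cA card_requiredSlots_filter)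
    (second _ cA' card_requiredSlots'_filter) main

end Probability

/-! ### One-hot points and orthogonal transforms -/

/-- The one-hot vectors, numbered by the position of their nonzero entry. -/
noncomputable def oneHotEquiv (n : ℕ) : Fin n ≃ oneHot n :=
  Equiv.ofBijective (fun i => ⟨EuclideanSpace.single i 1, by simp [oneHot]⟩) <| by
    constructor
    · intro i j h
      have h' := congrArg (fun v : EuclideanSpace ℝ (Fin n) => v i) (Subtype.ext_iff.1 h)
      by_contra hij
      simp [hij] at h'
    · rintro ⟨x, hx⟩
      simp only [oneHot, mem_image, mem_univ, true_and] at hx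
      obtain ⟨i, rfl⟩ := hx
      exact ⟨i, rfl⟩

theorem coe_oneHotEquiv {n : ℕ} (i : Fin n) :
    (oneHotEquiv n i : EuclideanSpace ℝ (Fin n)) = EuclideanSpace.single i 1 := rfl

/-- The slots of `n / 6` disjoint blocks of six one-hot vectors. At most five one-hot vectors are
in no block. -/
noncomputable def blockEmb (n : ℕ) : Fin 6 × Fin (n / 6) ↪ oneHot n where
  toFun p := oneHotEquiv n ⟨6 * p.2 + p.1, by
    have h1 := p.1.isLt
    have h2 := p.2.isLt
    omega⟩
  inj' p q h := by
    have h1 := p.1.isLt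
    have h2 := q.1.isLt
    have h3 := Fin.mk.inj_iff.1 ((oneHotEquiv n).injective h)
    exact Prod.ext (Fin.ext (by omega)) (Fin.ext (by omega))

theorem one_le_longDist (T : ℝ≥0) : 1 ≤ longDist T := le_add_self

/-- The quasimetric space on the one-hot vectors of `ℝⁿ` that defeats the level `t`. -/
noncomputable def gadgetSpace (n : ℕ) (t : ℝ) :
    FiniteQuasimetricSpace (EuclideanSpace ℝ (Fin n)) where
  points := oneHot n
  dist := gadgetDist (blockEmb n) (longDist t.toNNReal)
  dist_eq_zero_iff := gadgetDist_eq_zero_iff _ (one_le_longDist _)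
  dist_triangle := gadgetDist_triangle _ (one_le_longDist _)

theorem card_oneHot (n : ℕ) : (oneHot n).card = n := by
  have h := Fintype.card_congr (oneHotEquiv n)
  rw [Fintype.card_fin, Fintype.card_coe] at h
  exact h.symm

/-- An orthogonal transform of `ℝ²ⁿ` can permute the one-hot vectors in the two components of a
pair independently. -/
theorem exists_orthogonal_concat {n : ℕ} (π ρ : Equiv.Perm (oneHot n)) :
    ∃ U : PairSpace n ≃ₗᵢ[ℝ] PairSpace n, ∀ x y : oneHot n,
      U (concat (x : EuclideanSpace ℝ (Fin n)) y) =
        concat (π x : EuclideanSpace ℝ (Fin n)) (ρ y) := by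
  let π' : Equiv.Perm (Fin n) := ((oneHotEquiv n).trans π).trans (oneHotEquiv n).symm
  let ρ' : Equiv.Perm (Fin n) := ((oneHotEquiv n).trans ρ).trans (oneHotEquiv n).symm
  refine ⟨LinearIsometryEquiv.piLpCongrLeft 2 ℝ ℝ (Equiv.sumCongr π' ρ'), fun x y => ?_⟩
  have key : ∀ (σ : Equiv.Perm (oneHot n)) (x : oneHot n) (i : Fin n),
      (x : EuclideanSpace ℝ (Fin n))
        ((((oneHotEquiv n).trans σ).trans (oneHotEquiv n).symm).symm i) =
      (σ x : EuclideanSpace ℝ (Fin n)) i := by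
    intro σ x i
    obtain ⟨j, rfl⟩ := (oneHotEquiv n).surjective x
    obtain ⟨l, hl⟩ := (oneHotEquiv n).surjective (σ (oneHotEquiv n j))
    rw [← hl, coe_oneHotEquiv, coe_oneHotEquiv]
    simp only [PiLp.single_apply]
    refine if_congr ?_ rfl rfl
    rw [Equiv.symm_apply_eq]
    simp [← hl]
  ext s
  rw [LinearIsometryEquiv.piLpCongrLeft_apply]
  rcases s with i | i
  · exact key π x i
  · exact key ρ y i

/-- Training on `S` and on its image under `(π, ρ)` gives the same predictor up to `(π, ρ)` if the
targets do not change, because an orthogonal transform carries the inputs along. -/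
theorem predictor_map {n : ℕ} {t : ℝ} {Alg : LearningAlgorithm (PairSpace n) ℝ}
    (hAlg : IsEquivariant (orthogonalTransforms (PairSpace n)) Alg)
    (π ρ : Equiv.Perm (gadgetSpace n t).points)
    {S : Finset ((gadgetSpace n t).points × (gadgetSpace n t).points)}
    (hS : ∀ p ∈ S, (gadgetSpace n t).dist (π p.1) (ρ p.2) = (gadgetSpace n t).dist p.1 p.2)
    (x y : (gadgetSpace n t).points) :
    predictor (gadgetSpace n t) Alg S x y =
      predictor (gadgetSpace n t) Alg (S.map (π.prodCongr ρ).toEmbedding) (π x) (ρ y) := by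
  obtain ⟨U, hU⟩ := exists_orthogonal_concat π ρ
  have hdata : transformData U (trainingData (gadgetSpace n t) S) =
      trainingData (gadgetSpace n t) (S.map (π.prodCongr ρ).toEmbedding) := by
    unfold transformData trainingData
    ext q
    simp only [mem_image, mem_map, exists_exists_and_eq_and]
    refine exists_congr fun p => and_congr_right fun hp => ?_
    have h1 := hU p.1 p.2
    have h2 := hS p hp
    simp only [Equiv.coe_toEmbedding, Equiv.prodCongr_apply, Prod.map]
    rw [h1, h2]
    exact Iff.rfl
  unfold predictor
  rw [hAlg U ⟨U, rfl⟩, Function.comp_apply, hdata]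
  exact congrArg _ (hU x y)

theorem half_sub_sqrt_le_trainingProb_fails {n m : ℕ} (t : ℝ) (hn : 1 ≤ n / 6) (hm : 8 ≤ m)
    (hm' : m + 24 ≤ n ^ 2) {Alg : LearningAlgorithm (PairSpace n) ℝ}
    (hAlg : IsEquivariant (orthogonalTransforms (PairSpace n)) Alg) :
    1 / 2 - √(relVariance (n ^ 2) m (n / 6)) ≤
      trainingProb (gadgetSpace n t).points m fun S =>
        Fails (gadgetSpace n t).dist S t (predictor (gadgetSpace n t) Alg S) := by
  classical
  have hcard : Fintype.card ((gadgetSpace n t).points × (gadgetSpace n t).points) = n ^ 2 := by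
    rw [Fintype.card_prod, Fintype.card_coe, gadgetSpace, card_oneHot, sq]
  rw [← hcard] at hm' ⊢
  refine half_sub_sqrt_relVariance_le (V := (gadgetSpace n t).points) (blockEmb n) hn hm hm'
    fun θ S hA hB => ?_
  refine fails_or_fails_of_slots (ι := blockEmb n) (θ := θ) (fun x y => ?_) hA
  exact predictor_map hAlg _ _
    (fun p hp => gadgetDist_slotPerm (blockEmb n) θ _ fun h => disjoint_left.1 hB h hp) x y

end QuasimetricLearning

namespace QuasimetricLearning

open Filter

/-! ### Asymptotics of the relative variance -/

/-- The densities `p` of the sampled and `q` of the unsampled pairs enter the variance bound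
through `1 / (p ^ 2 * q ^ 3)`. One of them is at least `1 / 2`. -/
theorem one_div_sq_mul_cube_le {p q : ℝ} (hp : 0 < p) (hq : 0 < q) (hpq : p + q = 1) :
    1 / (p ^ 2 * q ^ 3) ≤ 8 * (1 / p ^ 2 + 1 / q ^ 3) := by
  have hp1 : 0 < 1 / p ^ 2 := by positivity
  have hq1 : 0 < 1 / q ^ 3 := by positivity
  have e : 1 / (p ^ 2 * q ^ 3) = 1 / p ^ 2 * (1 / q ^ 3) := by field_simp
  rw [e]
  rcases le_total (1 / 2) q with h | h
  · have : 1 / q ^ 3 ≤ 8 := by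
      rw [div_le_iff₀ (by positivity)]
      have := pow_le_pow_left₀ (by norm_num) h 3
      linarith
    nlinarith
  · have : 1 / p ^ 2 ≤ 8 := by
      rw [div_le_iff₀ (by positivity)]
      have := pow_le_pow_left₀ (by norm_num) (show 1 / 2 ≤ p by linarith) 2
      linarith
    nlinarith

/-- The factor for a common coordinate, in terms of the densities. From `n ≥ 46` on, the
corrections to `m` and `n ^ 2 - m` cost a factor of at most `2` each, and `n / 6 ≥ n / 12` in
spite of the rounding, so `3072 = 2 ^ 5 * 12 * 8`. -/
theorem correlation_le {n m : ℕ} (hn : 46 ≤ n) (hm : n ≤ m) (hm' : m + n ≤ n ^ 2) :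
    (((n ^ 2 : ℕ) : ℝ) / ((m : ℝ) + 1 - (2 * 4 : ℕ))) ^ 2 *
      (((n ^ 2 : ℕ) : ℝ) / (((n ^ 2 : ℕ) : ℝ) - m + 1 - (2 * 12 : ℕ))) ^ 3 / (n / 6 : ℕ) ≤
    3072 * (1 / n * (1 / ((m : ℝ) / (n : ℝ) ^ 2) ^ 2 + 1 / (1 - (m : ℝ) / (n : ℝ) ^ 2) ^ 3)) := by
  have hn' : (46 : ℝ) ≤ n := by exact_mod_cast hn
  have h1 : (n : ℝ) ≤ m := by exact_mod_cast hm
  have h2 : (m : ℝ) + n ≤ (n : ℝ) ^ 2 := by exact_mod_cast hm'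
  have hN : (0 : ℝ) < (n : ℝ) ^ 2 := by positivity
  have hp : 0 < (m : ℝ) / (n : ℝ) ^ 2 := div_pos (by linarith) hN
  have hqe : 1 - (m : ℝ) / (n : ℝ) ^ 2 = ((n : ℝ) ^ 2 - m) / (n : ℝ) ^ 2 := by field_simp
  have hq : 0 < 1 - (m : ℝ) / (n : ℝ) ^ 2 := by
    rw [hqe]
    exact div_pos (by linarith) hN
  have hk : (n : ℝ) / 12 ≤ (n / 6 : ℕ) := by
    have : n ≤ 12 * (n / 6) := by omega
    have : (n : ℝ) ≤ 12 * (n / 6 : ℕ) := by exact_mod_cast this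
    linarith
  set p := (m : ℝ) / (n : ℝ) ^ 2 with hpdef
  set q := 1 - p with hqdef
  have e1 : ((n ^ 2 : ℕ) : ℝ) / ((m : ℝ) + 1 - (2 * 4 : ℕ)) ≤ 2 / p := by
    rw [hpdef]
    push_cast
    rw [div_div_eq_mul_div, div_le_div_iff₀ (by linarith) (by linarith)]
    nlinarith
  have e2 : ((n ^ 2 : ℕ) : ℝ) / (((n ^ 2 : ℕ) : ℝ) - m + 1 - (2 * 12 : ℕ)) ≤ 2 / q := by
    rw [hqe]
    push_cast
    rw [div_div_eq_mul_div, div_le_div_iff₀ (by linarith) (by linarith)]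
    nlinarith
  have p1 : 0 ≤ ((n ^ 2 : ℕ) : ℝ) / ((m : ℝ) + 1 - (2 * 4 : ℕ)) := by
    push_cast
    exact div_nonneg hN.le (by linarith)
  have p2 : 0 ≤ ((n ^ 2 : ℕ) : ℝ) / (((n ^ 2 : ℕ) : ℝ) - m + 1 - (2 * 12 : ℕ)) := by
    push_cast
    exact div_nonneg hN.le (by linarith)
  have hk0 : (0 : ℝ) < (n : ℝ) / 12 := by linarith
  calc _ ≤ (2 / p) ^ 2 * (2 / q) ^ 3 / ((n : ℝ) / 12) := by gcongr
    _ = 384 * (1 / n * (1 / (p ^ 2 * q ^ 3))) := by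
      field_simp
      ring
    _ ≤ 384 * (1 / n * (8 * (1 / p ^ 2 + 1 / q ^ 3))) := by
      gcongr
      exact one_div_sq_mul_cube_le hp hq (by ring)
    _ = _ := by ring

theorem le_of_rpow_le_div {n m : ℕ} {r : ℝ} (hn : 1 ≤ n) (hr : -1 ≤ r)
    (h : (n : ℝ) ^ r ≤ (m : ℝ) / (n : ℝ) ^ 2) : n ≤ m := by
  have hn' : (1 : ℝ) ≤ n := by exact_mod_cast hn
  have h1 : (n : ℝ) ^ (-1 : ℝ) ≤ (m : ℝ) / (n : ℝ) ^ 2 :=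
    (Real.rpow_le_rpow_of_exponent_le hn' hr).trans h
  rw [Real.rpow_neg_one, le_div_iff₀ (by positivity)] at h1
  have h2 : (n : ℝ)⁻¹ * (n : ℝ) ^ 2 = n := by field_simp
  rw [h2] at h1
  exact_mod_cast h1

/-- The two growth conditions say that `1 / (n * p ^ 2)` and `1 / (n * q ^ 3)` tend to `0`, where
`p` and `q` are the densities of the sampled and the unsampled pairs. -/
theorem tendsto_sqrt_relVariance {m : ℕ → ℕ} (hm : ∀ n, m n ≤ n ^ 2)
    (hp : (fun n : ℕ => (n : ℝ) ^ (-(1 / 2) : ℝ)) =o[atTop]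
      (fun n : ℕ => (m n : ℝ) / (n : ℝ) ^ 2))
    (hq : (fun n : ℕ => (n : ℝ) ^ (-(1 / 3) : ℝ)) =o[atTop]
      (fun n : ℕ => 1 - (m n : ℝ) / (n : ℝ) ^ 2)) :
    (∀ᶠ n in atTop, n ≤ m n ∧ m n + n ≤ n ^ 2) ∧
      Tendsto (fun n => √(relVariance (n ^ 2) (m n) (n / 6))) atTop (𝓝 0) := by
  have hq0 : ∀ n : ℕ, 1 ≤ n → 1 - (m n : ℝ) / (n : ℝ) ^ 2 =
      ((n ^ 2 - m n : ℕ) : ℝ) / (n : ℝ) ^ 2 := by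
    intro n hn
    have : (0 : ℝ) < n := by exact_mod_cast hn
    rw [Nat.cast_sub (hm n)]
    push_cast
    field_simp
  have hev : ∀ᶠ n in atTop, n ≤ m n ∧ m n + n ≤ n ^ 2 := by
    filter_upwards [hp.bound one_pos, hq.bound one_pos, eventually_ge_atTop 1] with n h1 h2 hn
    rw [one_mul, Real.norm_of_nonneg (by positivity), Real.norm_of_nonneg (by positivity)] at h1
    rw [hq0 n hn, one_mul, Real.norm_of_nonneg (by positivity),
      Real.norm_of_nonneg (by positivity)] at h2
    have h3 := le_of_rpow_le_div hn (by norm_num) h1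
    have h4 := le_of_rpow_le_div hn (by norm_num) h2
    have := hm n
    omega
  refine ⟨hev, ?_⟩
  have t1 := hp.tendsto_div_nhds_zero.pow 2
  have t2 := hq.tendsto_div_nhds_zero.pow 3
  have t3 : Tendsto (fun n : ℕ => (3072 : ℝ) * (1 / n * (1 / ((m n : ℝ) / (n : ℝ) ^ 2) ^ 2 +
      1 / (1 - (m n : ℝ) / (n : ℝ) ^ 2) ^ 3))) atTop (𝓝 0) := by
    have t4 := (t1.add t2).const_mul (3072 : ℝ)
    norm_num only [zero_pow, add_zero, mul_zero] at t4
    refine t4.congr' ?_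
    filter_upwards [eventually_ge_atTop 1] with n hn
    have e1 : ((n : ℝ) ^ (-(1 / 2) : ℝ)) ^ 2 = 1 / n := by
      rw [← Real.rpow_natCast, ← Real.rpow_mul (by positivity)]
      norm_num [Real.rpow_neg_one]
    have e2 : ((n : ℝ) ^ (-(1 / 3) : ℝ)) ^ 3 = 1 / n := by
      rw [← Real.rpow_natCast, ← Real.rpow_mul (by positivity)]
      norm_num [Real.rpow_neg_one]
    rw [div_pow, e1, div_pow ((n : ℝ) ^ (-(1 / 3) : ℝ)), e2]
    ring
  have t5 : Tendsto (fun n : ℕ => ((((n ^ 2 : ℕ) : ℝ) / ((m n : ℝ) + 1 - (2 * 4 : ℕ))) ^ 2 *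
      (((n ^ 2 : ℕ) : ℝ) / (((n ^ 2 : ℕ) : ℝ) - m n + 1 - (2 * 12 : ℕ))) ^ 3) / (n / 6 : ℕ))
      atTop (𝓝 0) := by
    refine squeeze_zero' ?_ ?_ t3
    · filter_upwards [hev, eventually_ge_atTop 46] with n h hn
      have h1 : ((n : ℝ)) ≤ m n := by exact_mod_cast h.1
      have h2 : (m n : ℝ) + n ≤ (n ^ 2 : ℕ) := by exact_mod_cast h.2
      have hn' : (46 : ℝ) ≤ n := by exact_mod_cast hn
      refine div_nonneg (mul_nonneg (sq_nonneg _)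
        (pow_nonneg (div_nonneg (Nat.cast_nonneg _) ?_) _)) (Nat.cast_nonneg _)
      push_cast at h2 ⊢
      linarith
    · filter_upwards [hev, eventually_ge_atTop 46] with n h hn
      exact correlation_le hn h.1 h.2
  have t6 : Tendsto (fun n : ℕ => ((n ^ 2 : ℕ) : ℝ) /
      (((n ^ 2 : ℕ) : ℝ) + 1 - (2 * 4 + 2 * 12 : ℕ))) atTop (𝓝 1) := by
    have h1 : Tendsto (fun x : ℝ => x / (x + 1 - (2 * 4 + 2 * 12 : ℕ))) atTop (𝓝 1) := by
      have h2 : Tendsto (fun x : ℝ => 1 + 31 / (x + -31)) atTop (𝓝 (1 + 0)) :=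
        tendsto_const_nhds.add (Tendsto.const_div_atTop
          (tendsto_atTop_add_const_right _ _ tendsto_id) _)
      rw [add_zero] at h2
      refine h2.congr' ?_
      filter_upwards [eventually_gt_atTop 31] with x hx
      have : x + -31 ≠ 0 := by linarith
      have e : x + 1 - ((2 * 4 + 2 * 12 : ℕ) : ℝ) = x + -31 := by
        push_cast
        ring
      rw [e]
      field_simp
      ring
    exact h1.comp (tendsto_natCast_atTop_atTop.comp (tendsto_pow_atTop two_ne_zero))
  have t7 := (((t6.pow (2 * 4 + 2 * 12)).mul ((t5.const_add 1).pow 4)).sub_const 1).sqrt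
  simpa [relVariance] using t7

end QuasimetricLearning

theorem mainTheorem2 (f : ℕ → ℝ) :
    ∃ M : (n : ℕ) → QuasimetricLearning.FiniteQuasimetricSpace (EuclideanSpace ℝ (Fin n)),
      (∀ n, (M n).points = QuasimetricLearning.oneHot n ∧ (M n).points.card = n) ∧
      ∀ m : ℕ → ℕ, (∀ n, m n ≤ n ^ 2) →
        (fun n : ℕ => (n : ℝ) ^ (-(1 / 2) : ℝ)) =o[Filter.atTop]
          (fun n : ℕ => (m n : ℝ) / (n : ℝ) ^ 2) →
        (fun n : ℕ => (n : ℝ) ^ (-(1 / 3) : ℝ)) =o[Filter.atTop]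
          (fun n : ℕ => 1 - (m n : ℝ) / (n : ℝ) ^ 2) →
        ∃ ε : ℕ → ℝ, Filter.Tendsto ε Filter.atTop (𝓝 0) ∧
          ∀ (n : ℕ) (Alg : QuasimetricLearning.LearningAlgorithm
              (QuasimetricLearning.PairSpace n) ℝ),
            QuasimetricLearning.IsEquivariant
              (QuasimetricLearning.orthogonalTransforms (QuasimetricLearning.PairSpace n)) Alg →
            1 / 2 - ε n ≤
              QuasimetricLearning.trainingProb (M n).points (m n) (fun S =>
                QuasimetricLearning.Fails (M n).dist S (f n)
                  (QuasimetricLearning.predictor (M n) Alg S)) := by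
  classical
  refine ⟨fun n => QuasimetricLearning.gadgetSpace n (f n),
    fun n => ⟨rfl, QuasimetricLearning.card_oneHot n⟩, fun m hm hp hq => ?_⟩
  obtain ⟨hev, hlim⟩ := QuasimetricLearning.tendsto_sqrt_relVariance hm hp hq
  -- For the finitely many `n` without room for the gadget, the error `1 / 2` makes the bound
  -- trivial.
  refine ⟨fun n => if 1 ≤ n / 6 ∧ 8 ≤ m n ∧ m n + 24 ≤ n ^ 2 then
    √(QuasimetricLearning.relVariance (n ^ 2) (m n) (n / 6)) else 1 / 2, ?_, ?_⟩
  · refine hlim.congr' ?_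
    filter_upwards [hev, Filter.eventually_ge_atTop 24] with n h hn
    exact (if_pos ⟨by omega, by omega, by omega⟩).symm
  · intro n Alg hAlg
    beta_reduce
    split_ifs with h
    · exact QuasimetricLearning.half_sub_sqrt_le_trainingProb_fails (f n) h.1 h.2.1 h.2.2 hAlg
    · rw [sub_self]
      exact div_nonneg (Nat.cast_nonneg _) (Nat.cast_nonneg _)
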